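/- Let $\alpha,\beta,\gamma,\delta,\epsilon,q,t\in\mathbb{C}$ with $t\neq 0,1$ and $\gamma+\delta+\epsilon=\alpha+\beta+1$, and consider Heun's differential equation $$\frac{d^2y}{dz^2}+\left(\frac{\gamma}{z}+\frac{\delta}{z-1}+\frac{\epsilon}{z-t}\right)\frac{dy}{dz}+\frac{\alpha\beta z-q}{z(z-1)(z-t)}\,y=0 .$$ Assume that $\alpha\in\mathbb{Z}$, $\epsilon\in\mathbb{Z}$ and that the singularity $z=t$ (with exponents $0$ and $1-\epsilon$) is apparent, i.e. near $z=t$ there is a basis of solutions without logarithmic terms, of the form $u(z)$, $(z-t)^{1-\epsilon}v(z)$ with $u,v$ holomorphic at $t$ and $u(t)v(t)\neq 0$. Then the monodromy representation of the fundamental group $\pi_1(\mathbb{C}\setminus\{0,1,t\},b)$ (for any base point $b$) on the space of (multivalued) solutions of the equation, given by analytic continuation along loops, is reducible: there is an invariant linear subspace other than $\{0\}$ and the whole solution space. -/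

import Mathlib

noncomputable section

/-- The data of a Heun equation
`y'' + (γ/z + δ/(z-1) + ε/(z-t)) y' + (αβz - q)/(z(z-1)(z-t)) y = 0`
over `ℂ`: the finite singularities `0, 1, t` are distinct and the Fuchs relation holds. -/
structure HeunEquation where
  α : ℂ
  β : ℂ
  γ : ℂ
  δ : ℂ
  ε : ℂ
  q : ℂ
  t : ℂ
  t_ne_zero : t ≠ 0
  t_ne_one : t ≠ 1
  fuchs : γ + δ + ε = α + β + 1

namespace HeunEquation

variable (E : HeunEquation)

/-- The domain `ℂ \ {0, 1, t}` as a set. -/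
def domain : Set ℂ := {z | z ≠ 0 ∧ z ≠ 1 ∧ z ≠ E.t}

/-- `y` is a holomorphic solution of the Heun equation on `U ⊆ ℂ \ {0, 1, t}`
(used only for open `U`). -/
def IsSolutionOn (U : Set ℂ) (y : ℂ → ℂ) : Prop :=
  U ⊆ E.domain ∧ DifferentiableOn ℂ y U ∧
    ∀ z ∈ U, deriv (deriv y) z
      + (E.γ / z + E.δ / (z - 1) + E.ε / (z - E.t)) * deriv y z
      + (E.α * E.β * z - E.q) / (z * (z - 1) * (z - E.t)) * y z = 0

/-- For `ε = n ∈ ℤ`, the singularity `z = t` (whose exponents are `0` and `1 - n`) is apparent: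
near `z = t` there is a basis of solutions without logarithmic term, that is, a basis
`f = u(z)`, `g = (z - t) ^ (1 - n) * v(z)` with `u, v` holomorphic at `t`, `u(t) ≠ 0`,
`v(t) ≠ 0`. -/
def IsApparent (n : ℤ) : Prop :=
  ∃ r : ℝ, 0 < r ∧ ∃ u v : ℂ → ℂ,
    DifferentiableOn ℂ u (Metric.ball E.t r) ∧ DifferentiableOn ℂ v (Metric.ball E.t r) ∧
    u E.t ≠ 0 ∧ v E.t ≠ 0 ∧
    E.IsSolutionOn (Metric.ball E.t r \ {E.t}) u ∧
    E.IsSolutionOn (Metric.ball E.t r \ {E.t}) (fun z => (z - E.t) ^ (1 - n) * v z) ∧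
    ∀ c₁ c₂ : ℂ,
      (∀ z ∈ Metric.ball E.t r \ {E.t}, c₁ * u z + c₂ * ((z - E.t) ^ (1 - n) * v z) = 0) →
      c₁ = 0 ∧ c₂ = 0

/-- The universal covering space of `ℂ \ {0, 1, t}` with base point `b`, as a set: pairs of a
point `x` and a homotopy class of paths from `b` to `x`. -/
abbrev UniversalCover (b : E.domain) : Type :=
  Σ x : E.domain, Path.Homotopic.Quotient b x

/-- A (multivalued) solution of the Heun equation: a function `F` on the universal cover which
near each point is a holomorphic solution. Namely, for each class `g` of paths from `b` to `x`
there is a disc about `x` and a holomorphic solution `y` on it such that, for every path `s` from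
`x` to `z` inside the disc, the value of `F` at `g` followed by `s` is `y z`. -/
def IsMultivaluedSolution (b : E.domain) (F : E.UniversalCover b → ℂ) : Prop :=
  ∀ (x : E.domain) (g : Path.Homotopic.Quotient b x),
    ∃ r : ℝ, 0 < r ∧ ∃ y : ℂ → ℂ, E.IsSolutionOn (Metric.ball (x : ℂ) r) y ∧
      ∀ (z : E.domain) (s : Path x z), (∀ τ, (s τ : ℂ) ∈ Metric.ball (x : ℂ) r) →
        F ⟨z, g.trans (Path.Homotopic.Quotient.mk s)⟩ = y z

/-- Solutions of the (linear, homogeneous) equation on an open set are closed under linear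
combinations. -/
theorem IsSolutionOn.linComb {U : Set ℂ} (hU : IsOpen U) {y₁ y₂ : ℂ → ℂ}
    (h₁ : E.IsSolutionOn U y₁) (h₂ : E.IsSolutionOn U y₂) (c₁ c₂ : ℂ) :
    E.IsSolutionOn U (fun z => c₁ * y₁ z + c₂ * y₂ z) := by
  obtain ⟨hs, d₁, e₁⟩ := h₁
  obtain ⟨-, d₂, e₂⟩ := h₂
  have key : ∀ {f g : ℂ → ℂ}, DifferentiableOn ℂ f U → DifferentiableOn ℂ g U → ∀ z ∈ U,
      deriv (fun z => c₁ * f z + c₂ * g z) z = c₁ * deriv f z + c₂ * deriv g z := by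
    intro f g hf hg z hz
    have a := (hf.differentiableAt (hU.mem_nhds hz)).hasDerivAt.const_mul c₁
    have b := (hg.differentiableAt (hU.mem_nhds hz)).hasDerivAt.const_mul c₂
    exact (a.add b).deriv
  refine ⟨hs, (d₁.const_mul c₁).add (d₂.const_mul c₂), fun z hz => ?_⟩
  have h2 : deriv (deriv (fun z => c₁ * y₁ z + c₂ * y₂ z)) z
      = c₁ * deriv (deriv y₁) z + c₂ * deriv (deriv y₂) z := by
    rw [← key (d₁.deriv hU) (d₂.deriv hU) z hz]
    apply Filter.EventuallyEq.deriv_eq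
    filter_upwards [hU.mem_nhds hz] with w hw using key d₁ d₂ w hw
  rw [h2, key d₁ d₂ z hz]
  linear_combination c₁ * e₁ z hz + c₂ * e₂ z hz

theorem IsSolutionOn.mono {U V : Set ℂ} (h : V ⊆ U) {y : ℂ → ℂ}
    (hy : E.IsSolutionOn U y) : E.IsSolutionOn V y :=
  ⟨h.trans hy.1, hy.2.1.mono h, fun z hz => hy.2.2 z (h hz)⟩

theorem isMultivaluedSolution_linComb (b : E.domain) {F G : E.UniversalCover b → ℂ}
    (hF : E.IsMultivaluedSolution b F) (hG : E.IsMultivaluedSolution b G) (c₁ c₂ : ℂ) :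
    E.IsMultivaluedSolution b (fun p => c₁ * F p + c₂ * G p) := by
  intro x g
  obtain ⟨r₁, p₁, y₁, s₁, e₁⟩ := hF x g
  obtain ⟨r₂, p₂, y₂, s₂, e₂⟩ := hG x g
  have i₁ := Metric.ball_subset_ball (x := (x : ℂ)) (min_le_left r₁ r₂)
  have i₂ := Metric.ball_subset_ball (x := (x : ℂ)) (min_le_right r₁ r₂)
  refine ⟨min r₁ r₂, lt_min p₁ p₂, fun z => c₁ * y₁ z + c₂ * y₂ z,
    IsSolutionOn.linComb E Metric.isOpen_ball (s₁.mono E i₁) (s₂.mono E i₂) c₁ c₂, ?_⟩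
  intro z s hs
  simp only [e₁ z s fun τ => i₁ (hs τ), e₂ z s fun τ => i₂ (hs τ)]

theorem isMultivaluedSolution_zero (b : E.domain) :
    E.IsMultivaluedSolution b (fun _ => 0) := by
  intro x g
  have ho : IsOpen E.domain := isOpen_ne.inter (isOpen_ne.inter isOpen_ne)
  obtain ⟨r, hr, hs⟩ := Metric.isOpen_iff.1 ho x x.2
  refine ⟨r, hr, fun _ => 0, ⟨hs, differentiableOn_const _, fun z _ => by simp⟩, ?_⟩
  intros
  rfl

/-- The complex vector space of (multivalued) solutions of the Heun equation. -/
def solutions (b : E.domain) : Submodule ℂ (E.UniversalCover b → ℂ) where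
  carrier := {F | E.IsMultivaluedSolution b F}
  zero_mem' := E.isMultivaluedSolution_zero b
  add_mem' {F G} hF hG := by
    have h := E.isMultivaluedSolution_linComb b hF hG 1 1
    simp only [one_mul] at h
    exact h
  smul_mem' c F hF := by
    have h := E.isMultivaluedSolution_linComb b hF hF c 0
    simp only [zero_mul, add_zero] at h
    exact h

theorem isMultivaluedSolution_translate (b : E.domain) (σ : Path.Homotopic.Quotient b b)
    {F : E.UniversalCover b → ℂ} (hF : E.IsMultivaluedSolution b F) :
    E.IsMultivaluedSolution b (fun p => F ⟨p.1, σ.trans p.2⟩) := by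
  intro x g
  obtain ⟨r, hr, y, hy, e⟩ := hF x (σ.trans g)
  refine ⟨r, hr, y, hy, fun z s hs => ?_⟩
  rw [← e z s hs]
  exact congrArg (fun k => F ⟨z, k⟩) (CategoryTheory.Category.assoc
    (W := FundamentalGroupoid.mk b) (X := FundamentalGroupoid.mk b)
    (Y := FundamentalGroupoid.mk x) (Z := FundamentalGroupoid.mk z)
    σ g (Path.Homotopic.Quotient.mk s)).symm

/-- The monodromy representation of the fundamental group of `ℂ \ {0, 1, t}` on the space of
solutions: the class of a loop `σ` sends `F` to its analytic continuation along `σ`, that is, to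
`g ↦ F (σ followed by g)`. -/
def monodromy (b : E.domain) :
    Representation ℂ (FundamentalGroup E.domain b) (E.solutions b) where
  toFun σ :=
    { toFun := fun F => ⟨fun p => F.1 ⟨p.1, Path.Homotopic.Quotient.trans σ.toPath p.2⟩,
        E.isMultivaluedSolution_translate b σ.toPath F.2⟩
      map_add' := fun _ _ => rfl
      map_smul' := fun _ _ => rfl }
  map_one' := by
    ext F p
    exact congrArg (fun k => F.1 ⟨p.1, k⟩) (CategoryTheory.Category.id_comp
      (X := FundamentalGroupoid.mk b) (Y := FundamentalGroupoid.mk p.1) p.2)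
  map_mul' σ σ' := by
    ext F p
    exact congrArg (fun k => F.1 ⟨p.1, k⟩) (CategoryTheory.Category.assoc
      (W := FundamentalGroupoid.mk b) (X := FundamentalGroupoid.mk b)
      (Y := FundamentalGroupoid.mk b) (Z := FundamentalGroupoid.mk p.1) σ'.toPath σ.toPath p.2)

/-- The monodromy representation with base point `b` is reducible: there is an invariant
subspace other than zero and the whole space of solutions. -/
def IsMonodromyReducible (b : E.domain) : Prop :=
  ∃ W : Subrepresentation (E.monodromy b), W ≠ ⊥ ∧ W ≠ ⊤

end HeunEquation

end

/-! Under analytic continuation `φ = z ^ a (z - 1) ^ b (z - t) ^ c` is only multiplied by constants.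
Hence a solution `φ p` with `p` a polynomial spans an invariant line in the two-dimensional space of
solutions.

To find such a solution, gauge by a power of `z - t` to reach `ε = -N` with `N ≥ 0`; the case
`ε = 1` does not occur, as the second solution would then have a logarithm. Let `E'` be the
equation with `γ, δ` replaced by `2 - γ, 2 - δ`. If `α = m` is a positive integer, then `E'` has
the exponent `1 - m - N ≤ 0` at infinity, so after exchanging `E` and `E'` if necessary, the Heun
operator of `E` maps the polynomials of degree at most `k` to themselves, for some `k`. If it is
not injective there, `E` has a polynomial solution. Otherwise `E p = 1` for some polynomial `p`.
Let `h` be the Taylor polynomial of degree `N` at `t` of a solution of `E'` holomorphic at `t`; as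
`N + 1` is an exponent of `E'` at `t`, `E' h = O((z - t) ^ (N + 1))`. By Lagrange's identity
`h (E p) - p (E' h)` has no term of degree `N` in `z - t`, so neither has `h (E p) = h`, i.e.
`deg h < N`. Then `E' h` has degree at most `N` and hence vanishes. -/

open Topology Polynomial Filter Metric

section LinearSystems

/-- `Y` solves the linear system of differential equations `Y' = A(z) Y` on `U`. -/
def SolvesLinearODE {V : Type*} [NormedAddCommGroup V] [NormedSpace ℂ V] (A : ℂ → V →L[ℂ] V)
    (U : Set ℂ) (Y : ℂ → V) : Prop :=
  ∀ z ∈ U, HasDerivAt Y (A z (Y z)) z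

namespace SolvesLinearODE

variable {V : Type*} [NormedAddCommGroup V] [NormedSpace ℂ V] {A : ℂ → V →L[ℂ] V}
  {U : Set ℂ} {Y Y₁ Y₂ : ℂ → V}

theorem mono {U' : Set ℂ} (h : SolvesLinearODE A U Y) (hU : U' ⊆ U) : SolvesLinearODE A U' Y :=
  fun z hz => h z (hU hz)

theorem add (h₁ : SolvesLinearODE A U Y₁) (h₂ : SolvesLinearODE A U Y₂) :
    SolvesLinearODE A U (Y₁ + Y₂) := fun z hz => by
  simpa only [Pi.add_apply, map_add] using (h₁ z hz).add (h₂ z hz)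

theorem const_smul (h : SolvesLinearODE A U Y) (k : ℂ) : SolvesLinearODE A U (k • Y) :=
  fun z hz => by simpa only [Pi.smul_apply, map_smul] using (h z hz).const_smul k

theorem sub (h₁ : SolvesLinearODE A U Y₁) (h₂ : SolvesLinearODE A U Y₂) :
    SolvesLinearODE A U (Y₁ - Y₂) := fun z hz => by
  simpa only [Pi.sub_apply, map_sub] using (h₁ z hz).sub (h₂ z hz)

theorem differentiableOn (h : SolvesLinearODE A U Y) : DifferentiableOn ℂ Y U :=
  fun z hz => (h z hz).differentiableAt.differentiableWithinAt

variable [CompleteSpace V]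

-- If `Y = (z - a) ^ (k + 1) s` with `s(a) ≠ 0`, comparing lowest order terms gives
-- `(k + 1) s(a) = 0`.
theorem eventually_eq_zero {a : ℂ} (hA : ContinuousAt A a) (hU : U ∈ 𝓝 a)
    (h : SolvesLinearODE A U Y) (ha : Y a = 0) : ∀ᶠ z in 𝓝 a, Y z = 0 := by
  have hYa : AnalyticAt ℂ Y a := h.differentiableOn.analyticAt hU
  by_contra hne
  obtain ⟨n, s, hs, hsa, hYs⟩ := hYa.exists_eventuallyEq_pow_smul_nonzero_iff.2 hne
  obtain ⟨k, rfl⟩ : ∃ k, n = k + 1 := by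
    refine Nat.exists_eq_succ_of_ne_zero ?_
    rintro rfl
    have := hYs.self_of_nhds
    simp only [ha, pow_zero, one_smul] at this
    exact hsa this.symm
  have hpunctured : ∀ᶠ z in 𝓝[≠] a,
      ((k + 1 : ℕ) : ℂ) • s z + (z - a) • deriv s z = (z - a) • A z (s z) := by
    filter_upwards [self_mem_nhdsWithin, nhdsWithin_le_nhds hU,
      nhdsWithin_le_nhds hYs.eventually_nhds,
      nhdsWithin_le_nhds hs.eventually_analyticAt] with z hza hzU hz hsz
    have hpow : HasDerivAt (fun w => (w - a) ^ (k + 1)) (((k + 1 : ℕ) : ℂ) * (z - a) ^ k) z := by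
      simpa using ((hasDerivAt_id z).sub_const a).fun_pow (k + 1)
    have hderiv := (h z hzU).unique
      ((hpow.smul hsz.differentiableAt.hasDerivAt).congr_of_eventuallyEq hz)
    rw [hz.self_of_nhds, map_smul] at hderiv
    refine (smul_right_injective V (pow_ne_zero k (sub_ne_zero.2 hza))) ?_
    simp only [smul_add, smul_smul, ← pow_succ]
    rw [hderiv, add_comm, mul_comm ((z - a) ^ k)]
  have hleft : ContinuousAt (fun z => ((k + 1 : ℕ) : ℂ) • s z + (z - a) • deriv s z) a :=
    (hs.continuousAt.const_smul _).add
      ((continuousAt_id.sub continuousAt_const).smul hs.deriv.continuousAt)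
  have hright : ContinuousAt (fun z => (z - a) • A z (s z)) a :=
    (continuousAt_id.sub continuousAt_const).smul (hA.clm_apply hs.continuousAt)
  have hlimit := ((hleft.eventuallyEq_nhds_iff_eventuallyEq_nhdsNE hright).1
    hpunctured).self_of_nhds
  simp only [sub_self, zero_smul, add_zero, smul_eq_zero, hsa, or_false, Nat.cast_eq_zero] at hlimit
  omega

theorem eqOn (hU : IsOpen U) (hUc : IsPreconnected U) (hA : ContinuousOn A U)
    (h₁ : SolvesLinearODE A U Y₁) (h₂ : SolvesLinearODE A U Y₂) {a : ℂ} (ha : a ∈ U)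
    (h : Y₁ a = Y₂ a) : Set.EqOn Y₁ Y₂ U := by
  have hsub := h₁.sub h₂
  have hanalytic := hsub.differentiableOn.analyticOnNhd hU
  have hzero := hanalytic.eqOn_zero_of_preconnected_of_eventuallyEq_zero hUc ha
    (hsub.eventually_eq_zero (hA.continuousAt (hU.mem_nhds ha)) (hU.mem_nhds ha)
      (by simp [h]))
  exact fun z hz => sub_eq_zero.1 (hzero hz)

theorem eqOn_ball_inter_ball {c c' : ℂ} {r r' : ℝ} (hA : ContinuousOn A (ball c r))
    (h₁ : SolvesLinearODE A (ball c r) Y₁) (h₂ : SolvesLinearODE A (ball c' r') Y₂) {a : ℂ}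
    (ha : a ∈ ball c r ∩ ball c' r') (h : Y₁ a = Y₂ a) :
    Set.EqOn Y₁ Y₂ (ball c r ∩ ball c' r') :=
  (h₁.mono Set.inter_subset_left).eqOn (isOpen_ball.inter isOpen_ball)
    ((convex_ball c r).inter (convex_ball c' r')).isPreconnected (hA.mono Set.inter_subset_left)
    (h₂.mono Set.inter_subset_right) ha h

end SolvesLinearODE

section Existence

variable {V : Type*} [NormedAddCommGroup V] [NormedSpace ℂ V] {A : ℂ → V →L[ℂ] V}
  {c a : ℂ} {r M : ℝ}

theorem norm_picard_term_le (ha : a ∈ ball c r) (hM : ∀ z ∈ ball c r, ‖A z‖ ≤ M)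
    (hrM : 2 * r * M ≤ 1 / 2) {v : V} {Y : ℕ → ℂ → V} (hY0 : Y 0 = fun _ => v)
    (hYa : ∀ n, Y (n + 1) a = 0)
    (hY : ∀ n, ∀ z ∈ ball c r, HasDerivAt (Y (n + 1)) (A z (Y n z)) z) (n : ℕ) :
    ∀ z ∈ ball c r, ‖Y n z‖ ≤ ‖v‖ * (1 / 2) ^ n := by
  induction n with
  | zero => intro z _; simp [hY0]
  | succ n ih =>
    intro z hz
    have hM0 : 0 ≤ M := (norm_nonneg _).trans (hM a ha)
    have hbound : ∀ w ∈ ball c r, ‖A w (Y n w)‖ ≤ M * (‖v‖ * (1 / 2) ^ n) := fun w hw =>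
      (A w).le_of_opNorm_le_of_le (hM w hw) (ih w hw)
    have hmean := (convex_ball c r).norm_image_sub_le_of_norm_hasDerivWithin_le
      (fun w hw => (hY n w hw).hasDerivWithinAt) hbound ha hz
    have hdist : ‖z - a‖ ≤ 2 * r := by
      rw [← dist_eq_norm]
      linarith [dist_triangle_right z a c, mem_ball.1 hz, mem_ball.1 ha]
    calc ‖Y (n + 1) z‖ ≤ M * (‖v‖ * (1 / 2) ^ n) * ‖z - a‖ := by simpa [hYa n] using hmean
      _ ≤ M * (‖v‖ * (1 / 2) ^ n) * (2 * r) := by gcongr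
      _ = 2 * r * M * (‖v‖ * (1 / 2) ^ n) := by ring
      _ ≤ 1 / 2 * (‖v‖ * (1 / 2) ^ n) := by gcongr
      _ = ‖v‖ * (1 / 2) ^ (n + 1) := by ring

variable [CompleteSpace V]

theorem exists_picard_terms (hA : DifferentiableOn ℂ A (ball c r)) (a : ℂ) (v : V) :
    ∃ Y : ℕ → ℂ → V, Y 0 = (fun _ => v) ∧ ∀ n, Y (n + 1) a = 0 ∧
      ∀ z ∈ ball c r, HasDerivAt (Y (n + 1)) (A z (Y n z)) z := by
  have hprimitive : ∀ f : ℂ → V, DifferentiableOn ℂ f (ball c r) →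
      ∃ F : ℂ → V, F a = 0 ∧ ∀ z ∈ ball c r, HasDerivAt F (A z (f z)) z :=
    fun f hf => (hA.clm_apply hf).isExactOn_ball.with_val_at a 0
  choose! P hPa hP using hprimitive
  have hdiff : ∀ n, DifferentiableOn ℂ (P^[n] fun _ => v) (ball c r) := by
    intro n
    induction n with
    | zero => exact differentiableOn_const v
    | succ n ih =>
      rw [Function.iterate_succ_apply']
      exact fun z hz => (hP _ ih z hz).differentiableAt.differentiableWithinAt
  refine ⟨fun n => P^[n] fun _ => v, rfl, fun n => ?_⟩
  simp only [Function.iterate_succ_apply']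
  exact ⟨hPa _ (hdiff n), hP _ (hdiff n)⟩

theorem exists_solvesLinearODE_ball (hA : DifferentiableOn ℂ A (ball c r))
    (hM : ∀ z ∈ ball c r, ‖A z‖ ≤ M) (hrM : 2 * r * M ≤ 1 / 2) (ha : a ∈ ball c r) (v : V) :
    ∃ Y : ℂ → V, SolvesLinearODE A (ball c r) Y ∧ Y a = v := by
  obtain ⟨Y, hY0, hYsucc⟩ := exists_picard_terms hA a v
  have hnorm := norm_picard_term_le ha hM hrM hY0 (fun n => (hYsucc n).1) fun n => (hYsucc n).2
  have hgeom : Summable fun n : ℕ => ‖v‖ * (1 / 2 : ℝ) ^ n :=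
    (summable_geometric_of_lt_one (by norm_num) (by norm_num)).mul_left _
  have hsummable : ∀ z ∈ ball c r, Summable fun n => Y n z := fun z hz =>
    .of_norm_bounded hgeom fun n => hnorm n z hz
  have hsplit : ∀ z ∈ ball c r, ∑' n, Y n z = v + ∑' n, Y (n + 1) z := fun z hz => by
    rw [(hsummable z hz).tsum_eq_zero_add, hY0]
  refine ⟨fun z => ∑' n, Y n z, fun z hz => ?_, ?_⟩
  · have htail := hasDerivAt_tsum_of_isPreconnected (hgeom.mul_left M) isOpen_ball
      (convex_ball c r).isPreconnected (fun n => (hYsucc n).2)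
      (fun n w hw => (A w).le_of_opNorm_le_of_le (hM w hw) (hnorm n w hw)) ha
      ((summable_nat_add_iff 1).2 (hsummable a ha)) hz
    rw [← (A z).map_tsum (hsummable z hz)] at htail
    exact (htail.const_add v).congr_of_eventuallyEq
      (Filter.eventually_of_mem (isOpen_ball.mem_nhds hz) hsplit)
  · simp only [hsplit a ha, (hYsucc _).1, tsum_zero, add_zero]

theorem exists_radius_solvesLinearODE {Ω : Set ℂ} (hΩ : IsOpen Ω) (hA : DifferentiableOn ℂ A Ω)
    (hc : c ∈ Ω) : ∃ r > 0, ball c r ⊆ Ω ∧ ∀ a ∈ ball c r, ∀ v : V,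
      ∃ Y : ℂ → V, SolvesLinearODE A (ball c r) Y ∧ Y a = v := by
  set M := ‖A c‖ + 1
  have hM0 : 0 < M := by positivity
  have hbounded : ∀ᶠ z in 𝓝 c, z ∈ Ω ∧ ‖A z‖ < M := (hΩ.eventually_mem hc).and
    ((hA.continuousOn.continuousAt (hΩ.mem_nhds hc)).norm.eventually_lt_const (lt_add_one _))
  obtain ⟨ρ, hρ, hball⟩ := Metric.eventually_nhds_iff_ball.1 hbounded
  have hsub : ball c (min ρ (1 / (4 * M))) ⊆ ball c ρ := ball_subset_ball (min_le_left _ _)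
  have hΩsub : ball c (min ρ (1 / (4 * M))) ⊆ Ω := fun z hz => (hball z (hsub hz)).1
  refine ⟨min ρ (1 / (4 * M)), by positivity, hΩsub, fun a ha v =>
    exists_solvesLinearODE_ball (hA.mono hΩsub) (fun z hz => (hball z (hsub hz)).2.le) ?_ ha v⟩
  calc 2 * min ρ (1 / (4 * M)) * M ≤ 2 * (1 / (4 * M)) * M := by gcongr; exact min_le_right _ _
    _ = 1 / 2 := by field_simp; norm_num

end Existence

end LinearSystems

section LocalSystems

/-- A local system with fibre `F` on `X`, presented by charts: `chart c z v` is the value at `z`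
of the section over `nhd c` whose value at `c` is `v`. -/
structure LocalSystem (X F : Type*) [TopologicalSpace X] where
  nhd : X → Set X
  isOpen_nhd : ∀ c, IsOpen (nhd c)
  mem_nhd : ∀ c, c ∈ nhd c
  chart : X → X → F → F
  chart_self : ∀ c v, chart c c v = v
  bijective_chart : ∀ c, ∀ z ∈ nhd c, Function.Bijective (chart c z)
  chart_eq_of_chart_eq : ∀ {c c' v v' z z'}, z ∈ nhd c ∩ nhd c' → z' ∈ nhd c ∩ nhd c' →
    chart c z v = chart c' z v' → chart c z' v = chart c' z' v'

namespace LocalSystem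

variable {X F : Type*} [TopologicalSpace X] (S : LocalSystem X F)

/-- The transition function from the chart at `c` to the chart at `c'`, at the point `z`; it is
only meaningful for `z ∈ S.nhd c'`. -/
noncomputable def transition (c c' z : X) (v : F) : F :=
  haveI : Nonempty F := ⟨v⟩
  Function.invFun (S.chart c' z) (S.chart c z v)

variable {S} {c c' z : X}

theorem chart_transition (hz : z ∈ S.nhd c') (v : F) :
    S.chart c' z (S.transition c c' z v) = S.chart c z v :=
  haveI : Nonempty F := ⟨v⟩
  Function.invFun_eq ((S.bijective_chart c' z hz).2 _)

theorem transition_eq_iff (hz : z ∈ S.nhd c') {v w : F} :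
    S.transition c c' z v = w ↔ S.chart c z v = S.chart c' z w := by
  rw [← chart_transition hz v]
  exact (S.bijective_chart c' z hz).1.eq_iff.symm

variable [TopologicalSpace F] [DiscreteTopology F]

theorem continuousOn_transition (c c' : X) :
    ContinuousOn (fun p : X × F => S.transition c c' p.1 p.2)
      ((S.nhd c ∩ S.nhd c') ×ˢ Set.univ) := by
  rintro ⟨z, v⟩ ⟨hz, -⟩
  have hconst : ∀ᶠ p : X × F in 𝓝 (z, v), S.transition c c' z v = S.transition c c' p.1 p.2 := by
    rw [nhds_prod_eq, nhds_discrete F, Filter.prod_pure, Filter.eventually_map]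
    filter_upwards [(S.isOpen_nhd c).mem_nhds hz.1, (S.isOpen_nhd c').mem_nhds hz.2] with w hw hw'
    exact ((transition_eq_iff hw').2
      (S.chart_eq_of_chart_eq hz ⟨hw, hw'⟩ (chart_transition hz.2 v).symm)).symm
  exact (continuousAt_const.congr hconst).continuousWithinAt

variable (S) in
/-- The fibre bundle with discrete fibre defined by the transition functions. -/
noncomputable def bundleCore : FiberBundleCore X X F where
  baseSet := S.nhd
  isOpen_baseSet := S.isOpen_nhd
  indexAt := id
  mem_baseSet_at := S.mem_nhd
  coordChange := S.transition
  coordChange_self _ _ hz _ := (transition_eq_iff hz).2 rfl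
  continuousOn_coordChange := continuousOn_transition
  coordChange_comp _ _ _ _ hz _ := by
    rw [transition_eq_iff hz.2, chart_transition hz.1.2, chart_transition hz.2]

theorem isCoveringMap_proj : IsCoveringMap S.bundleCore.proj :=
  IsCoveringMap.mk _ (fun _ => F) S.bundleCore.localTriv S.mem_nhd

variable (S) in
/-- The fibre of the bundle over `x`, identified with `F` by means of the chart at `x`. -/
noncomputable def fiberEquiv (x : X) : F ≃ S.bundleCore.proj ⁻¹' {x} where
  toFun v := ⟨⟨x, v⟩, rfl⟩
  invFun e := e.1.2
  left_inv _ := rfl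
  right_inv := by
    rintro ⟨⟨x, w⟩, rfl⟩
    rfl

theorem continuous_fiberEquiv_chart {z : X} (s : Path c z) (hs : ∀ τ, s τ ∈ S.nhd c) (v : F) :
    Continuous fun τ => (S.fiberEquiv (s τ) (S.chart c (s τ) v)).1 := by
  have hsymm : Continuous fun τ =>
      (S.bundleCore.localTriv c).toOpenPartialHomeomorph.symm (s τ, v) :=
    (S.bundleCore.localTriv c).toOpenPartialHomeomorph.continuousOn_symm.comp_continuous
      (by fun_prop) fun τ => (S.bundleCore.mem_localTriv_target c (s τ, v)).2 (hs τ)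
  refine hsymm.congr fun τ => ?_
  change (S.fiberEquiv (s τ) (S.transition c (s τ) (s τ) v)).1 = _
  rw [(transition_eq_iff (S.mem_nhd _)).2 (S.chart_self _ _).symm]

theorem monodromy_mk {z : X} (s : Path c z) (hs : ∀ τ, s τ ∈ S.nhd c) (v : F) :
    S.isCoveringMap_proj.monodromy (.mk s) (S.fiberEquiv c v) =
      S.fiberEquiv z (S.chart c z v) := by
  have hlift := (S.isCoveringMap_proj.eq_liftPath_iff (γ := (s : C(unitInterval, X)))
    (e := (S.fiberEquiv c v).1) s.source).2 ⟨continuous_fiberEquiv_chart s hs v, rfl, by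
      rw [s.source, S.chart_self]⟩
  exact Subtype.ext ((congrFun hlift 1).symm.trans (by rw [s.target]))

omit [TopologicalSpace F] [DiscreteTopology F] in
variable (S) in
theorem exists_section (b : X) (v : F) :
    ∃ Y : (Σ x : X, Path.Homotopic.Quotient b x) → F, Y ⟨b, .refl b⟩ = v ∧
      ∀ (x : X) (g : Path.Homotopic.Quotient b x) (z : X) (s : Path x z),
        (∀ τ, s τ ∈ S.nhd x) → Y ⟨z, g.trans (.mk s)⟩ = S.chart x z (Y ⟨x, g⟩) := by
  let _ : TopologicalSpace F := ⊥
  have : DiscreteTopology F := ⟨rfl⟩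
  refine ⟨fun p => (S.fiberEquiv p.1).symm
    (S.isCoveringMap_proj.monodromy p.2 (S.fiberEquiv b v)), ?_, fun x g z s hs => ?_⟩
  · simp only [IsCoveringMap.monodromy_refl, id, Equiv.symm_apply_apply]
  · simp only [IsCoveringMap.monodromy_trans_apply]
    rw [Equiv.symm_apply_eq, ← monodromy_mk s hs, Equiv.apply_symm_apply]

end LocalSystem

end LocalSystems

section MultivaluedSolutions

variable {Ω : Set ℂ} {b : Ω}

/-- `y` is the branch at the path class `g` of the multivalued function `Φ`, on the disc of radius
`r` about the end point of `g`. -/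
def IsBranch {V : Type*} (Φ : (Σ x : Ω, Path.Homotopic.Quotient b x) → V) {x : Ω}
    (g : Path.Homotopic.Quotient b x) (r : ℝ) (y : ℂ → V) : Prop :=
  ∀ (z : Ω) (s : Path x z), (∀ τ, (s τ : ℂ) ∈ ball (x : ℂ) r) → Φ ⟨z, g.trans (.mk s)⟩ = y z

namespace IsBranch

variable {V : Type*} {Φ : (Σ x : Ω, Path.Homotopic.Quotient b x) → V} {x : Ω}
  {g : Path.Homotopic.Quotient b x} {r : ℝ} {y y' : ℂ → V}

theorem mono {r' : ℝ} (h : IsBranch Φ g r y) (hr : r' ≤ r) : IsBranch Φ g r' y :=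
  fun z s hs => h z s fun τ => ball_subset_ball hr (hs τ)

theorem translate {σ : Path.Homotopic.Quotient b b} (h : IsBranch Φ (σ.trans g) r y) :
    IsBranch (fun p => Φ ⟨p.1, σ.trans p.2⟩) g r y := fun z s hs => by
  rw [← h z s hs, Path.Homotopic.Quotient.trans_assoc]

theorem apply_eq (h : IsBranch Φ g r y) (hr : 0 < r) : Φ ⟨x, g⟩ = y x := by
  rw [← h x (.refl x) fun _ => mem_ball_self hr, Path.Homotopic.Quotient.mk_refl,
    Path.Homotopic.Quotient.trans_refl]

theorem comp {W : Type*} (h : IsBranch Φ g r y) (f : V → W) : IsBranch (f ∘ Φ) g r (f ∘ y) :=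
  fun z s hs => congrArg f (h z s hs)

theorem exists_path_mem_ball (hsub : ball (x : ℂ) r ⊆ Ω) {z : ℂ} (hz : z ∈ ball (x : ℂ) r) :
    ∃ s : Path x ⟨z, hsub hz⟩, ∀ τ, (s τ : ℂ) ∈ ball (x : ℂ) r := by
  have hx : (x : ℂ) ∈ ball (x : ℂ) r := mem_ball_self (pos_of_mem_ball hz)
  have hjoined :=
    (((convex_ball (x : ℂ) r).isPathConnected ⟨x, hx⟩).joinedIn x hx z hz).joined_subtype
  exact ⟨hjoined.somePath.map (continuous_inclusion hsub), fun τ => (hjoined.somePath τ).2⟩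

theorem eqOn (hsub : ball (x : ℂ) r ⊆ Ω) (h : IsBranch Φ g r y) (h' : IsBranch Φ g r y') :
    Set.EqOn y y' (ball x r) := fun z hz => by
  obtain ⟨s, hs⟩ := exists_path_mem_ball hsub hz
  exact (h _ s hs).symm.trans (h' _ s hs)

end IsBranch

variable {V : Type*} [NormedAddCommGroup V] [NormedSpace ℂ V] {A : ℂ → V →L[ℂ] V}

/-- `Φ` is a multivalued solution of `Y' = A(z) Y` on `Ω`: a function of a point of `Ω` and of a
homotopy class of paths to it from `b`, all of whose branches are solutions. -/
def IsMultivaluedODESolution (A : ℂ → V →L[ℂ] V)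
    (Φ : (Σ x : Ω, Path.Homotopic.Quotient b x) → V) : Prop :=
  ∀ (x : Ω) (g : Path.Homotopic.Quotient b x), ∃ r : ℝ, 0 < r ∧ ∃ y : ℂ → V,
    SolvesLinearODE A (ball x r) y ∧ IsBranch Φ g r y

namespace IsMultivaluedODESolution

variable {Φ Ψ : (Σ x : Ω, Path.Homotopic.Quotient b x) → V}

theorem exists_branch_le (h : IsMultivaluedODESolution A Φ) {x : Ω}
    (g : Path.Homotopic.Quotient b x) {ρ : ℝ} (hρ : 0 < ρ) : ∃ r : ℝ, 0 < r ∧ r ≤ ρ ∧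
      ∃ y : ℂ → V, SolvesLinearODE A (ball x r) y ∧ IsBranch Φ g r y := by
  obtain ⟨r, hr, y, hy, hbranch⟩ := h x g
  exact ⟨min r ρ, lt_min hr hρ, min_le_right r ρ, y,
    hy.mono (ball_subset_ball (min_le_left r ρ)), hbranch.mono (min_le_left r ρ)⟩

theorem exists_branch_subset (h : IsMultivaluedODESolution A Φ) (hΩ : IsOpen Ω) {x : Ω}
    (g : Path.Homotopic.Quotient b x) : ∃ r : ℝ, 0 < r ∧ ball (x : ℂ) r ⊆ Ω ∧
      ∃ y : ℂ → V, SolvesLinearODE A (ball x r) y ∧ IsBranch Φ g r y := by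
  obtain ⟨ρ, hρ, hsub⟩ := isOpen_iff.1 hΩ x x.2
  obtain ⟨r, hr, hrρ, y, hy, hbranch⟩ := h.exists_branch_le g hρ
  exact ⟨r, hr, (ball_subset_ball hrρ).trans hsub, y, hy, hbranch⟩

theorem add (hΦ : IsMultivaluedODESolution A Φ) (hΨ : IsMultivaluedODESolution A Ψ) :
    IsMultivaluedODESolution A (Φ + Ψ) := fun x g => by
  obtain ⟨r, hr, y, hy, hyΦ⟩ := hΦ x g
  obtain ⟨r', hr', hr'r, y', hy', hyΨ⟩ := hΨ.exists_branch_le g hr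
  refine ⟨r', hr', y + y', (hy.mono (ball_subset_ball hr'r)).add hy', fun z s hs => ?_⟩
  rw [Pi.add_apply, Pi.add_apply, hyΦ.mono hr'r z s hs, hyΨ z s hs]

theorem const_smul (hΦ : IsMultivaluedODESolution A Φ) (k : ℂ) :
    IsMultivaluedODESolution A (k • Φ) := fun x g => by
  obtain ⟨r, hr, y, hy, hyΦ⟩ := hΦ x g
  refine ⟨r, hr, k • y, hy.const_smul k, fun z s hs => ?_⟩
  rw [Pi.smul_apply, Pi.smul_apply, hyΦ z s hs]

theorem translate (hΦ : IsMultivaluedODESolution A Φ) (σ : Path.Homotopic.Quotient b b) :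
    IsMultivaluedODESolution A fun p => Φ ⟨p.1, σ.trans p.2⟩ := fun x g => by
  obtain ⟨r, hr, y, hy, hyΦ⟩ := hΦ x (σ.trans g)
  exact ⟨r, hr, y, hy, hyΦ.translate⟩

variable [CompleteSpace V]

theorem exists_localSystem (hΩ : IsOpen Ω) (hA : DifferentiableOn ℂ A Ω) :
    ∃ (S : LocalSystem Ω V) (r : Ω → ℝ), (∀ c, 0 < r c) ∧
      (∀ c, S.nhd c = Subtype.val ⁻¹' ball (c : ℂ) (r c)) ∧ ∀ (c : Ω) (v : V), ∃ Y : ℂ → V,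
        SolvesLinearODE A (ball (c : ℂ) (r c)) Y ∧ ∀ z : Ω, S.chart c z v = Y z := by
  choose r hr hsub hexists using fun c : Ω => exists_radius_solvesLinearODE hΩ hA c.2
  choose Y hY hYself using fun c v => hexists c c (mem_ball_self (hr c)) v
  have hcont : ∀ c : Ω, ContinuousOn A (ball (c : ℂ) (r c)) := fun c =>
    hA.continuousOn.mono (hsub c)
  have hmem : ∀ c : Ω, (c : ℂ) ∈ ball (c : ℂ) (r c) := fun c => mem_ball_self (hr c)
  refine ⟨{
    nhd := fun c => Subtype.val ⁻¹' ball (c : ℂ) (r c)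
    isOpen_nhd := fun c => isOpen_ball.preimage continuous_subtype_val
    mem_nhd := hmem
    chart := fun c z v => Y c v z
    chart_self := hYself
    bijective_chart := fun c z hz => ⟨fun v w hvw => ?_, fun w => ?_⟩
    chart_eq_of_chart_eq := fun {c c' v v' z z'} hz hz' h =>
      (hY c v).eqOn_ball_inter_ball (hcont c) (hY c' v') (a := z) hz h hz' },
    r, hr, fun _ => rfl, fun c v => ⟨Y c v, hY c v, fun _ => rfl⟩⟩
  · rw [← hYself c v, ← hYself c w]
    exact (hY c v).eqOn isOpen_ball (convex_ball _ _).isPreconnected (hcont c) (hY c w) hz hvw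
      (hmem c)
  · obtain ⟨y, hy, hyz⟩ := hexists c z hz w
    refine ⟨y c, hyz ▸ ?_⟩
    exact (hY c _).eqOn isOpen_ball (convex_ball _ _).isPreconnected (hcont c) hy (hmem c)
      (hYself c _) hz

theorem exists_apply_refl_eq (hΩ : IsOpen Ω) (hA : DifferentiableOn ℂ A Ω) (b : Ω) (v : V) :
    ∃ Φ : (Σ x : Ω, Path.Homotopic.Quotient b x) → V,
      IsMultivaluedODESolution A Φ ∧ Φ ⟨b, .refl b⟩ = v := by
  obtain ⟨S, r, hr, hnhd, hchart⟩ := exists_localSystem hΩ hA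
  obtain ⟨Φ, hΦb, hΦ⟩ := S.exists_section b v
  refine ⟨Φ, fun x g => ?_, hΦb⟩
  obtain ⟨Y, hY, hSY⟩ := hchart x (Φ ⟨x, g⟩)
  exact ⟨r x, hr x, Y, hY, fun z s hs => (hΦ x g z s (hnhd x ▸ hs)).trans (hSY z)⟩

end IsMultivaluedODESolution

end MultivaluedSolutions

section TaylorCoefficients

variable {R : Type*} [CommRing R]

theorem coeff_taylor_X_sub_C_mul_derivative (t : R) (N : ℕ) (f : R[X]) :
    (taylor t ((X - C t) * derivative f)).coeff N = N * (taylor t f).coeff N := by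
  have hX : taylor t (X - C t) = X := by simp
  have hd : taylor t (derivative f) = derivative (taylor t f) := by
    simp [taylor_apply, derivative_comp]
  rw [taylor_mul, hX, hd]
  cases N with
  | zero => simp
  | succ N =>
    rw [coeff_X_mul, coeff_derivative]
    push_cast
    ring

theorem coeff_taylor_of_natDegree_le (t : R) {N : ℕ} {f : R[X]} (hd : f.natDegree ≤ N) :
    (taylor t f).coeff N = f.coeff N := by
  rcases hd.lt_or_eq with hlt | rfl
  · rw [coeff_eq_zero_of_natDegree_lt hlt,
      coeff_eq_zero_of_natDegree_lt (by rwa [natDegree_taylor])]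
  · exact coeff_taylor_natDegree t f

end TaylorCoefficients

section TaylorPolynomials

variable {c : ℂ} {n : ℕ}

theorem exists_polynomial_add_pow_mul {f : ℂ → ℂ} (hf : AnalyticAt ℂ f c) (n : ℕ) :
    ∃ (g : ℂ[X]) (s : ℂ → ℂ), g.natDegree ≤ n ∧ AnalyticAt ℂ s c ∧
      ∀ z, f z = g.eval z + (z - c) ^ (n + 1) * s z := by
  have hshift : AnalyticAt ℂ (fun z => f (z + c)) 0 :=
    AnalyticAt.fun_comp (by rwa [zero_add]) (by fun_prop)
  obtain ⟨s, hs, hfs⟩ := hshift.exists_eq_sum_add_pow_mul (n + 1)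
  refine ⟨∑ i ∈ Finset.range (n + 1),
    C (iteratedDeriv i (fun z => f (z + c)) 0 / i.factorial) * (X - C c) ^ i,
    fun z => s (z - c), ?_, AnalyticAt.fun_comp (by rwa [sub_self]) (by fun_prop), fun z => ?_⟩
  · refine natDegree_sum_le_of_forall_le _ _ fun i hi => (natDegree_C_mul_le _ _).trans ?_
    rw [natDegree_pow, natDegree_X_sub_C, mul_one]
    exact Nat.le_of_lt_succ (Finset.mem_range.1 hi)
  · have hz := hfs (z - c)
    rw [sub_add_cancel] at hz
    rw [hz, eval_finsetSum]
    congr 1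
    refine Finset.sum_congr rfl fun i _ => ?_
    simp only [smul_eq_mul, eval_mul, eval_C, eval_pow, eval_sub, eval_X]
    ring

theorem eq_of_eventually_eq_nhdsNE {f g : ℂ → ℂ} (hf : ContinuousAt f c) (hg : ContinuousAt g c)
    (h : ∀ᶠ z in 𝓝[≠] c, f z = g z) : f c = g c :=
  ((hf.eventuallyEq_nhds_iff_eventuallyEq_nhdsNE hg).1 h).eq_of_nhds

theorem X_sub_C_pow_dvd_of_eventually_eq {f : ℂ[X]} {A : ℂ → ℂ} (hA : ContinuousAt A c)
    (h : ∀ᶠ z in 𝓝[≠] c, f.eval z = (z - c) ^ n * A z) : (X - C c) ^ n ∣ f := by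
  rcases eq_or_ne f 0 with rfl | hf
  · exact dvd_zero _
  obtain ⟨g, hfg, hgc⟩ := exists_eq_pow_rootMultiplicity_mul_and_not_dvd f hf c
  refine (le_rootMultiplicity_iff hf).1 ?_
  by_contra! hlt
  obtain ⟨k, hk⟩ := Nat.exists_eq_add_of_lt hlt
  rw [dvd_iff_isRoot, IsRoot.def] at hgc
  have hval : g.eval c = (c - c) ^ (k + 1) * A c := by
    refine eq_of_eventually_eq_nhdsNE (f := fun z => g.eval z)
      (g := fun z => (z - c) ^ (k + 1) * A z) (by fun_prop) (by fun_prop) ?_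
    filter_upwards [h, self_mem_nhdsWithin] with z hz hzc
    apply mul_left_cancel₀ (pow_ne_zero (rootMultiplicity c f) (sub_ne_zero.2 hzc))
    rw [hfg, eval_mul, eval_pow, eval_sub, eval_X, eval_C, hk] at hz
    linear_combination hz
  exact hgc (by simpa using hval)

end TaylorPolynomials

namespace HeunEquation

variable (E : HeunEquation)

section Operator

/-- The Heun operator with denominators cleared. -/
noncomputable def heunOp (f : ℂ → ℂ) (z : ℂ) : ℂ :=
  z * (z - 1) * (z - E.t) * deriv (deriv f) z
    + (E.γ * ((z - 1) * (z - E.t)) + E.δ * (z * (z - E.t)) + E.ε * (z * (z - 1))) * deriv f z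
    + (E.α * E.β * z - E.q) * f z

variable {E}

theorem isOpen_domain : IsOpen E.domain := isOpen_ne.inter (isOpen_ne.inter isOpen_ne)

theorem eventually_mem_domain : ∀ᶠ z in 𝓝[≠] E.t, z ∈ E.domain := by
  filter_upwards [nhdsWithin_le_nhds (isOpen_ne.mem_nhds E.t_ne_zero),
    nhdsWithin_le_nhds (isOpen_ne.mem_nhds E.t_ne_one), self_mem_nhdsWithin] with z h0 h1 ht
  exact ⟨h0, h1, ht⟩

theorem isSolutionOn_iff {U : Set ℂ} {y : ℂ → ℂ} : E.IsSolutionOn U y ↔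
    U ⊆ E.domain ∧ DifferentiableOn ℂ y U ∧ ∀ z ∈ U, E.heunOp y z = 0 := by
  refine and_congr_right fun hU => and_congr_right fun _ => forall₂_congr fun z hz => ?_
  obtain ⟨h0, h1, ht⟩ := hU hz
  have hz1 := sub_ne_zero.2 h1
  have hzt := sub_ne_zero.2 ht
  have hclear : E.heunOp y z = z * (z - 1) * (z - E.t) * (deriv (deriv y) z
      + (E.γ / z + E.δ / (z - 1) + E.ε / (z - E.t)) * deriv y z
      + (E.α * E.β * z - E.q) / (z * (z - 1) * (z - E.t)) * y z) := by
    simp only [heunOp]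
    field_simp
  rw [hclear, mul_eq_zero, or_iff_right (mul_ne_zero (mul_ne_zero h0 hz1) hzt)]

theorem heunOp_congr {f g : ℂ → ℂ} {z : ℂ} (h : f =ᶠ[𝓝 z] g) : E.heunOp f z = E.heunOp g z := by
  rw [heunOp, heunOp, h.deriv.deriv_eq, h.deriv_eq, h.eq_of_nhds]

theorem heunOp_add {f g : ℂ → ℂ} {z : ℂ} (hf : AnalyticAt ℂ f z) (hg : AnalyticAt ℂ g z) :
    E.heunOp (f + g) z = E.heunOp f z + E.heunOp g z := by
  have hderiv : deriv (f + g) =ᶠ[𝓝 z] deriv f + deriv g := by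
    filter_upwards [hf.eventually_analyticAt, hg.eventually_analyticAt] with w hfw hgw
    exact deriv_add hfw.differentiableAt hgw.differentiableAt
  rw [heunOp, hderiv.deriv_eq, hderiv.eq_of_nhds,
    deriv_add hf.deriv.differentiableAt hg.deriv.differentiableAt]
  simp only [heunOp, Pi.add_apply]
  ring

theorem analyticAt_heunOp {f : ℂ → ℂ} {z : ℂ} (hf : AnalyticAt ℂ f z) :
    AnalyticAt ℂ (E.heunOp f) z := by
  have := hf.deriv
  have := hf.deriv.deriv
  unfold heunOp
  fun_prop

end Operator

section Gauge

/-- The Heun equation for `φ⁻¹ y`, where `y` solves `E` and `φ = z ^ a (z - 1) ^ b (z - t) ^ c`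
for exponents `a, b, c` of `E` at `0, 1, t`. -/
def gauge (a b c : ℂ) : HeunEquation where
  α := E.α + (a + b + c)
  β := E.β + (a + b + c)
  γ := E.γ + 2 * a
  δ := E.δ + 2 * b
  ε := E.ε + 2 * c
  q := E.q + (2 * a * b + E.γ * b + E.δ * a) * E.t + (2 * a * c + E.γ * c + E.ε * a)
  t := E.t
  t_ne_zero := E.t_ne_zero
  t_ne_one := E.t_ne_one
  fuchs := by linear_combination E.fuchs

/-- `a`, `b` and `c` are exponents of `E` at `0`, `1` and `t`: roots of the indicial equations. -/
def IsExponents (a b c : ℂ) : Prop :=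
  a * (a - 1 + E.γ) = 0 ∧ b * (b - 1 + E.δ) = 0 ∧ c * (c - 1 + E.ε) = 0

/-- The logarithmic derivative of `z ^ a (z - 1) ^ b (z - t) ^ c`. -/
noncomputable def logDer (a b c z : ℂ) : ℂ := a / z + b / (z - 1) + c / (z - E.t)

variable {E} {a b c a' b' c' : ℂ}

theorem gauge_zero : E.gauge 0 0 0 = E := by
  simp [gauge]

theorem gauge_gauge :
    (E.gauge a b c).gauge a' b' c' = E.gauge (a + a') (b + b') (c + c') := by
  simp only [gauge, mk.injEq, and_true]
  refine ⟨?_, ?_, ?_, ?_, ?_, ?_⟩ <;> ring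

theorem isExponents_zero : E.IsExponents 0 0 0 := by
  simp [IsExponents]

theorem IsExponents.add (h : E.IsExponents a b c) (h' : (E.gauge a b c).IsExponents a' b' c') :
    E.IsExponents (a + a') (b + b') (c + c') := by
  obtain ⟨ha, hb, hc⟩ := h
  obtain ⟨ha', hb', hc'⟩ := h'
  simp only [gauge] at ha' hb' hc'
  exact ⟨by linear_combination ha + ha', by linear_combination hb + hb',
    by linear_combination hc + hc'⟩

theorem hasDerivAt_logDer {z : ℂ} (hz : z ∈ E.domain) :
    HasDerivAt (E.logDer a b c) (-(a / z ^ 2) - b / (z - 1) ^ 2 - c / (z - E.t) ^ 2) z := by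
  obtain ⟨h0, h1, ht⟩ := hz
  have hsimple : ∀ k x : ℂ, z ≠ x → HasDerivAt (fun z => k / (z - x)) (-(k / (z - x) ^ 2)) z := by
    intro k x hx
    simpa [div_eq_mul_inv] using
      (((hasDerivAt_id z).sub_const x).fun_inv (sub_ne_zero.2 hx)).const_mul k
  have h := ((hsimple a 0 h0).fun_add (hsimple b 1 h1)).fun_add (hsimple c E.t ht)
  simp only [sub_zero] at h
  exact h.congr_deriv (by ring)

theorem hasDerivAt_zpow_sub (n : ℤ) {z : ℂ} (hz : z ≠ E.t) : HasDerivAt (fun w => (w - E.t) ^ n)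
    (E.logDer 0 0 n z * (z - E.t) ^ n) z := by
  have hzt := sub_ne_zero.2 hz
  refine ((hasDerivAt_zpow n (z - E.t) (.inl hzt)).comp_sub_const z E.t).congr_deriv ?_
  rw [zpow_sub_one₀ hzt, logDer]
  ring

theorem heunOp_mul {φ w : ℂ → ℂ} {z : ℂ} (hz : z ∈ E.domain)
    (hφ : ∀ᶠ x in 𝓝 z, HasDerivAt φ (E.logDer a b c x * φ x) x) (hw : AnalyticAt ℂ w z) :
    E.heunOp (φ * w) z = φ z * ((E.gauge a b c).heunOp w z
      + (a * (a - 1 + E.γ) * ((z - 1) * (z - E.t) / z - z)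
        + b * (b - 1 + E.δ) * (z * (z - E.t) / (z - 1) - z)
        + c * (c - 1 + E.ε) * (z * (z - 1) / (z - E.t) - z)) * w z) := by
  have hderiv : deriv (φ * w) =ᶠ[𝓝 z] φ * (E.logDer a b c * w + deriv w) := by
    filter_upwards [hφ, hw.eventually_analyticAt] with x hφx hwx
    rw [(hφx.mul hwx.differentiableAt.hasDerivAt).deriv]
    simp only [Pi.mul_apply, Pi.add_apply]
    ring
  have hderiv2 := (hφ.self_of_nhds.mul (((hasDerivAt_logDer (a := a) (b := b) (c := c) hz).mul
    hw.differentiableAt.hasDerivAt).add hw.deriv.differentiableAt.hasDerivAt)).deriv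
  rw [heunOp, hderiv.deriv_eq, hderiv.eq_of_nhds, hderiv2]
  obtain ⟨h0, h1, ht⟩ := hz
  have hz1 := sub_ne_zero.2 h1
  have hzt := sub_ne_zero.2 ht
  have hβ : E.β = E.γ + E.δ + E.ε - E.α - 1 := by linear_combination -E.fuchs
  simp only [Pi.add_apply, Pi.mul_apply, heunOp, gauge, logDer, hβ]
  field_simp
  ring

theorem IsExponents.heunOp_mul (h : E.IsExponents a b c) {φ w : ℂ → ℂ} {z : ℂ} (hz : z ∈ E.domain)
    (hφ : ∀ᶠ x in 𝓝 z, HasDerivAt φ (E.logDer a b c x * φ x) x) (hw : AnalyticAt ℂ w z) :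
    E.heunOp (φ * w) z = φ z * (E.gauge a b c).heunOp w z := by
  rw [HeunEquation.heunOp_mul hz hφ hw, h.1, h.2.1, h.2.2]
  ring

end Gauge

section PolynomialSolutions

/-- The Heun operator on polynomials. -/
noncomputable def polyOp : ℂ[X] →ₗ[ℂ] ℂ[X] where
  toFun p := X * (X - 1) * (X - C E.t) * derivative (derivative p)
    + (C E.γ * ((X - 1) * (X - C E.t)) + C E.δ * (X * (X - C E.t)) + C E.ε * (X * (X - 1)))
      * derivative p + (C (E.α * E.β) * X - C E.q) * p
  map_add' p₁ p₂ := by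
    simp only [derivative_add]
    ring
  map_smul' c p := by
    simp only [smul_eq_C_mul, derivative_C_mul, RingHom.id_apply]
    ring

/-- The Heun equation with `γ` and `δ` replaced by `2 - γ` and `2 - δ`, whose solutions are those
of `E` divided by `z ^ (1 - γ) (z - 1) ^ (1 - δ)`. Up to the weight `(z - t) ^ ε` it is the adjoint
of `E`, see `mul_polyOp_sub_mul_polyOp_conj`. -/
def conj : HeunEquation := E.gauge (1 - E.γ) (1 - E.δ) 0

/-- Some solution has the form `z ^ a (z - 1) ^ b (z - t) ^ c p(z)` with exponents `a, b, c` of `E`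
and a nonzero polynomial `p`. -/
def HasElementarySolution : Prop :=
  ∃ (a b c : ℂ) (p : ℂ[X]), E.IsExponents a b c ∧ p ≠ 0 ∧ (E.gauge a b c).polyOp p = 0

variable {E}

theorem polyOp_apply (p : ℂ[X]) : E.polyOp p =
    X * (X - 1) * (X - C E.t) * derivative (derivative p)
    + (C E.γ * ((X - 1) * (X - C E.t)) + C E.δ * (X * (X - C E.t)) + C E.ε * (X * (X - 1)))
      * derivative p + (C (E.α * E.β) * X - C E.q) * p := rfl

theorem heunOp_eval (p : ℂ[X]) (z : ℂ) :
    E.heunOp (fun w => p.eval w) z = (E.polyOp p).eval z := by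
  have hderiv : deriv (fun w => p.eval w) = fun w => (derivative p).eval w :=
    funext fun _ => p.deriv
  rw [heunOp, hderiv, (derivative p).deriv, polyOp_apply]
  simp

theorem HasElementarySolution.of_gauge {a b c : ℂ} (habc : E.IsExponents a b c)
    (h : (E.gauge a b c).HasElementarySolution) : E.HasElementarySolution := by
  obtain ⟨a', b', c', p, habc', hp, hker⟩ := h
  exact ⟨_, _, _, p, habc.add habc', hp, by rwa [← gauge_gauge]⟩

theorem isExponents_conj : E.IsExponents (1 - E.γ) (1 - E.δ) 0 :=
  ⟨by ring, by ring, by ring⟩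

theorem conj_conj : E.conj.conj = E := by
  rw [conj, conj, gauge_gauge]
  convert E.gauge_zero using 2
  · simp only [gauge]
    ring
  · simp only [gauge]
    ring
  · ring

theorem coeff_polyOp_succ {p : ℂ[X]} {k : ℕ} (hp : p.natDegree ≤ k) :
    (E.polyOp p).coeff (k + 1) = (k + E.α) * (k + E.β) * p.coeff k := by
  have hexpand : E.polyOp p = X * (X * (X * derivative (derivative p)))
      - C (1 + E.t) * (X * (X * derivative (derivative p)))
      + C E.t * (X * derivative (derivative p))
      + C (E.α + E.β + 1) * (X * (X * derivative p))
      - C (E.γ * (1 + E.t) + E.δ * E.t + E.ε) * (X * derivative p) + C (E.γ * E.t) * derivative p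
      + C (E.α * E.β) * (X * p) - C E.q * p := by
    rw [← E.fuchs, polyOp_apply]
    simp only [map_add, map_mul, map_one]
    ring
  have hcoeff : ∀ j, k < j → p.coeff j = 0 := fun j hj =>
    coeff_eq_zero_of_natDegree_lt (hp.trans_lt hj)
  rw [hexpand]
  simp only [coeff_add, coeff_sub, coeff_C_mul]
  rcases k with _ | _ | k
  · simp [coeff_derivative, hcoeff]
  · simp [coeff_X_mul, coeff_derivative, hcoeff]
    ring
  · simp [coeff_X_mul, coeff_derivative, hcoeff]
    ring

theorem degree_polyOp_lt {p : ℂ[X]} {k : ℕ} (hp : p.natDegree ≤ k)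
    (hk : (k + E.α) * (k + E.β) * p.coeff k = 0) : (E.polyOp p).degree < (k + 1 : ℕ) := by
  rw [degree_lt_iff_coeff_zero]
  rintro (_ | j) hj
  · omega
  rw [coeff_polyOp_succ (hp.trans (Nat.le_of_succ_le_succ hj))]
  rcases (Nat.le_of_succ_le_succ hj).eq_or_lt with rfl | hlt
  · exact hk
  · rw [coeff_eq_zero_of_natDegree_lt (hp.trans_lt hlt), mul_zero]

theorem exists_polyOp_eq_zero_or_one (k : ℕ) (hk : (k + E.α) * (k + E.β) = 0) :
    (∃ p : ℂ[X], p ≠ 0 ∧ E.polyOp p = 0) ∨ ∃ p : ℂ[X], E.polyOp p = 1 := by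
  have hmap : ∀ p ∈ degreeLT ℂ (k + 1), E.polyOp p ∈ degreeLT ℂ (k + 1) := by
    intro p hp
    rw [mem_degreeLT] at hp ⊢
    refine degree_polyOp_lt ?_ (by rw [hk, zero_mul])
    exact natDegree_le_of_degree_le (Order.lt_succ_iff.1 hp)
  let T := E.polyOp.restrict hmap
  by_cases hT : Function.Injective T
  · right
    obtain ⟨p, hp⟩ := LinearMap.injective_iff_surjective.1 hT
      ⟨1, by rw [mem_degreeLT, degree_one]; exact_mod_cast k.succ_pos⟩
    exact ⟨p, congrArg Subtype.val hp⟩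
  · left
    rw [← LinearMap.ker_eq_bot, ← ne_eq, Submodule.ne_bot_iff] at hT
    obtain ⟨p, hp, hp0⟩ := hT
    exact ⟨p, fun h => hp0 (Subtype.ext h), congrArg Subtype.val hp⟩

/-- Lagrange's identity. The right hand side is `(z - t) ^ (1 - ε) ((z - t) ^ ε B)'`, so for
`ε = -N` it has no term of degree `N` in `z - t`. -/
theorem mul_polyOp_sub_mul_polyOp_conj (p h : ℂ[X]) :
    ∃ B : ℂ[X], h * E.polyOp p - p * E.conj.polyOp h =
      (X - C E.t) * derivative B + C E.ε * B := by
  refine ⟨X * (X - 1) * (derivative p * h - p * derivative h)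
    - (C (1 - E.γ) * (X - 1) + C (1 - E.δ) * X) * (p * h), ?_⟩
  have hβ : E.β = E.γ + E.δ + E.ε - E.α - 1 := by linear_combination -E.fuchs
  simp only [polyOp_apply, conj, gauge, derivative_mul, derivative_X, derivative_C,
    derivative_one, map_add, map_mul, map_sub, hβ, map_one, map_zero, C_ofNat]
  ring

theorem coeff_taylor_mul_polyOp {N : ℕ} (hε : E.ε = -N) (p h : ℂ[X]) :
    (taylor E.t (h * E.polyOp p)).coeff N = (taylor E.t (p * E.conj.polyOp h)).coeff N := by
  obtain ⟨B, hB⟩ := E.mul_polyOp_sub_mul_polyOp_conj p h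
  rw [← sub_eq_zero, ← coeff_sub, ← map_sub, hB, map_add, coeff_add,
    coeff_taylor_X_sub_C_mul_derivative, taylor_mul, taylor_C, coeff_C_mul, hε]
  ring

theorem polyOp_eq_zero_of_dvd {N : ℕ} {t : ℂ} {g : ℂ[X]} (hd : g.natDegree ≤ N)
    (hg : (X - C t) ^ (N + 1) ∣ E.polyOp g) (h0 : g.coeff N = 0) : E.polyOp g = 0 := by
  refine eq_zero_of_dvd_of_degree_lt hg ?_
  rw [degree_pow, degree_X_sub_C, nsmul_one]
  exact_mod_cast degree_polyOp_lt hd (by rw [h0, mul_zero])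

theorem hasElementarySolution_of_dvd {N k : ℕ} (hε : E.ε = -N) (hk : (k + E.α) * (k + E.β) = 0)
    {h : ℂ[X]} (h0 : h ≠ 0) (hd : h.natDegree ≤ N)
    (hdvd : (X - C E.t) ^ (N + 1) ∣ E.conj.polyOp h) : E.HasElementarySolution := by
  rcases exists_polyOp_eq_zero_or_one k hk with ⟨p, hp, hker⟩ | ⟨p, hp⟩
  · exact ⟨0, 0, 0, p, isExponents_zero, hp, by rwa [gauge_zero]⟩
  -- Pairing `h` with `p` turns `E p = 1` into the vanishing of the top coefficient of `h`.
  have htop : (taylor E.t h).coeff N = 0 := by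
    have hpair := coeff_taylor_mul_polyOp hε p h
    rw [hp, mul_one] at hpair
    rw [hpair]
    exact X_pow_dvd_iff.1 (X_sub_C_pow_dvd_iff.1 (hdvd.mul_left p)) N N.lt_succ_self
  rw [coeff_taylor_of_natDegree_le _ hd] at htop
  exact ⟨_, _, _, h, isExponents_conj, h0, polyOp_eq_zero_of_dvd hd hdvd htop⟩

end PolynomialSolutions

section ApparentSingularity

/-- Some solution is holomorphic at `t` with a nonzero value there. -/
def HasRegularSolution : Prop :=
  ∃ u : ℂ → ℂ, AnalyticAt ℂ u E.t ∧ u E.t ≠ 0 ∧ ∀ᶠ z in 𝓝[≠] E.t, E.heunOp u z = 0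

variable {E}

theorem exists_eventually_hasDerivAt_logDer (a b : ℂ) : ∃ φ : ℂ → ℂ, φ E.t = 1 ∧
    ∀ᶠ z in 𝓝 E.t, HasDerivAt φ (E.logDer a b 0 z * φ z) z := by
  let Ω : Set ℂ := {z | z ≠ 0 ∧ z - 1 ≠ 0}
  have hΩ : IsOpen Ω := isOpen_ne.inter (isOpen_ne_fun (by fun_prop) (by fun_prop))
  have hA : DifferentiableOn ℂ
      (fun z => (a / z + b / (z - 1)) • ContinuousLinearMap.id ℂ ℂ) Ω := by
    rintro z ⟨h0, h1⟩
    exact DifferentiableAt.differentiableWithinAt (by fun_prop (disch := assumption))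
  obtain ⟨r, hr, -, hexists⟩ :=
    exists_radius_solvesLinearODE hΩ hA ⟨E.t_ne_zero, sub_ne_zero.2 E.t_ne_one⟩
  obtain ⟨φ, hφ, hφt⟩ := hexists E.t (mem_ball_self hr) 1
  refine ⟨φ, hφt, ?_⟩
  filter_upwards [ball_mem_nhds E.t hr] with z hz
  exact (hφ z hz).congr_deriv (by simp [logDer])

theorem HasRegularSolution.of_gauge {a b : ℂ} (hab : E.IsExponents a b 0)
    (h : (E.gauge a b 0).HasRegularSolution) : E.HasRegularSolution := by
  obtain ⟨u, (hu : AnalyticAt ℂ u E.t), (hut : u E.t ≠ 0), hsol⟩ := h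
  obtain ⟨φ, hφt, hφ⟩ := E.exists_eventually_hasDerivAt_logDer a b
  have hφa : AnalyticAt ℂ φ E.t :=
    Complex.analyticAt_iff_eventually_differentiableAt.2 (hφ.mono fun _ h => h.differentiableAt)
  refine ⟨φ * u, hφa.mul hu, by simpa [hφt] using hut, ?_⟩
  filter_upwards [eventually_mem_domain, nhdsWithin_le_nhds hφ.eventually_nhds,
    nhdsWithin_le_nhds hu.eventually_analyticAt, hsol] with z hz hφz huz hsolz
  rw [hab.heunOp_mul hz hφz huz, hsolz, mul_zero]

theorem HasRegularSolution.conj (h : E.HasRegularSolution) : E.conj.HasRegularSolution :=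
  .of_gauge isExponents_conj (by rwa [← HeunEquation.conj, conj_conj])

theorem HasRegularSolution.exists_X_sub_C_pow_dvd_polyOp {N : ℕ} (hε : E.ε = -N)
    (h : E.HasRegularSolution) :
    ∃ g : ℂ[X], g ≠ 0 ∧ g.natDegree ≤ N ∧ (X - C E.t) ^ (N + 1) ∣ E.polyOp g := by
  obtain ⟨u, hu, hut, hsol⟩ := h
  obtain ⟨g, s, hd, hs, hugs⟩ := exists_polynomial_add_pow_mul hu N
  have hg0 : g ≠ 0 := by
    rintro rfl
    exact hut (by simp [hugs E.t])
  -- `N + 1` is an exponent at `t`, so the remainder only contributes from order `N + 1` on.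
  have hexp : E.IsExponents 0 0 (N + 1) := ⟨by ring, by ring, by rw [hε]; ring⟩
  refine ⟨g, hg0, hd, X_sub_C_pow_dvd_of_eventually_eq
    (A := fun z => -(E.gauge 0 0 (N + 1)).heunOp s z) (analyticAt_heunOp hs).continuousAt.neg ?_⟩
  filter_upwards [eventually_mem_domain, hsol, nhdsWithin_le_nhds hs.eventually_analyticAt]
    with z hz hsolz hsz
  have hpow : ∀ᶠ x in 𝓝 z, HasDerivAt (fun w => (w - E.t) ^ (N + 1))
      (E.logDer 0 0 (N + 1) x * (x - E.t) ^ (N + 1)) x := by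
    filter_upwards [isOpen_domain.mem_nhds hz] with x hx
    exact_mod_cast hasDerivAt_zpow_sub (N + 1 : ℕ) hx.2.2
  have hsplit : u = (fun w => g.eval w) + (fun w => (w - E.t) ^ (N + 1)) * s := funext hugs
  rw [hsplit, heunOp_add (g.differentiable.analyticAt z) (AnalyticAt.mul (by fun_prop) hsz),
    heunOp_eval, hexp.heunOp_mul hz hpow hsz] at hsolz
  linear_combination hsolz

theorem HasRegularSolution.hasElementarySolution {m : ℤ} {N : ℕ} (hα : E.α = m) (hε : E.ε = -N)
    (h : E.HasRegularSolution) : E.HasElementarySolution := by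
  have hεconj : E.conj.ε = -N := by simp [HeunEquation.conj, gauge, hε]
  rcases le_or_gt m 0 with hm | hm
  · obtain ⟨k, rfl⟩ := Int.exists_eq_neg_ofNat hm
    obtain ⟨g, hg0, hd, hdvd⟩ := h.conj.exists_X_sub_C_pow_dvd_polyOp hεconj
    exact hasElementarySolution_of_dvd (k := k) hε (by simp [hα]) hg0 hd hdvd
  · obtain ⟨k, rfl⟩ : ∃ k : ℕ, m = k + 1 := ⟨(m - 1).toNat, by omega⟩
    obtain ⟨g, hg0, hd, hdvd⟩ := h.exists_X_sub_C_pow_dvd_polyOp hε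
    have hinfty : ((k + N : ℕ) : ℂ) + E.conj.β = 0 := by
      have hfuchs := E.fuchs
      rw [hε, hα] at hfuchs
      simp only [HeunEquation.conj, gauge]
      push_cast at hfuchs ⊢
      linear_combination -hfuchs
    have hconj : E.conj.HasElementarySolution :=
      hasElementarySolution_of_dvd hεconj (by rw [hinfty, mul_zero]) hg0 hd (by rwa [conj_conj])
    exact .of_gauge isExponents_conj hconj

theorem eventually_eq_zero_of_heunOp_eq_zero (hε : E.ε = 1) {w : ℂ → ℂ} (hw : AnalyticAt ℂ w E.t)
    (hwt : w E.t = 0) (hsol : ∀ᶠ z in 𝓝[≠] E.t, E.heunOp w z = 0) : ∀ᶠ z in 𝓝 E.t, w z = 0 := by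
  by_contra hne
  obtain ⟨n, s, hs, hst, hws⟩ := hw.exists_eventuallyEq_pow_smul_nonzero_iff.2 hne
  have hn : n ≠ 0 := by
    rintro rfl
    simpa [hwt, eq_comm, hst] using hws.self_of_nhds
  -- The exponents at `t` are `0, 0`, so the leading term of `E w` has coefficient `n ^ 2 s(t)`.
  have hlead : (E.t - E.t) * ((E.gauge 0 0 n).heunOp s E.t - n ^ 2 * E.t * s E.t)
      + n ^ 2 * E.t * (E.t - 1) * s E.t = 0 := by
    refine eq_of_eventually_eq_nhdsNE (f := fun z =>
      (z - E.t) * ((E.gauge 0 0 n).heunOp s z - n ^ 2 * z * s z) + n ^ 2 * z * (z - 1) * s z)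
      ?_ continuousAt_const ?_
    · have := (analyticAt_heunOp (E := E.gauge 0 0 n) hs).continuousAt
      have := hs.continuousAt
      fun_prop
    filter_upwards [eventually_mem_domain, hsol, nhdsWithin_le_nhds hws.eventually_nhds,
      nhdsWithin_le_nhds hs.eventually_analyticAt] with z hz hsolz hwsz hsz
    have hpow : ∀ᶠ x in 𝓝 z, HasDerivAt (fun w => (w - E.t) ^ n)
        (E.logDer 0 0 n x * (x - E.t) ^ n) x := by
      filter_upwards [isOpen_domain.mem_nhds hz] with x hx
      exact_mod_cast hasDerivAt_zpow_sub (n : ℤ) hx.2.2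
    have hzt := sub_ne_zero.2 hz.2.2
    have hprod : w =ᶠ[𝓝 z] (fun w => (w - E.t) ^ n) * s := hwsz
    rw [heunOp_congr hprod, heunOp_mul hz hpow hsz, mul_eq_zero,
      or_iff_right (pow_ne_zero n hzt), hε] at hsolz
    simp only [zero_mul, zero_add, sub_add_cancel] at hsolz
    field_simp at hsolz
    linear_combination hsolz
  simp [hn, hst, E.t_ne_zero, sub_ne_zero.2 E.t_ne_one] at hlead

theorem IsSolutionOn.eventually_heunOp_eq_zero {r : ℝ} (hr : 0 < r) {y : ℂ → ℂ}
    (h : E.IsSolutionOn (ball E.t r \ {E.t}) y) : ∀ᶠ z in 𝓝[≠] E.t, E.heunOp y z = 0 := by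
  filter_upwards [nhdsWithin_le_nhds (ball_mem_nhds E.t hr), self_mem_nhdsWithin] with z hz hzt
  exact (isSolutionOn_iff.1 h).2.2 z ⟨hz, hzt⟩

theorem not_isApparent_one (hε : E.ε = 1) : ¬ E.IsApparent 1 := by
  rintro ⟨r, hr, u, v, hu, hv, -, hvt, hsolu, hsolv, hindep⟩
  simp only [sub_self, zpow_zero, one_mul] at hsolv hindep
  let w : ℂ → ℂ := fun z => v E.t * u z + -u E.t * v z
  have hw : DifferentiableOn ℂ w (ball E.t r) := (hu.const_mul _).add (hv.const_mul _)
  have hsol := hsolu.linComb E (isOpen_ball.sdiff isClosed_singleton) hsolv (v E.t) (-u E.t)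
  have hzero := eventually_eq_zero_of_heunOp_eq_zero hε (hw.analyticAt (ball_mem_nhds E.t hr))
    (by simp only [w]; ring) (hsol.eventually_heunOp_eq_zero hr)
  have heqOn := (hw.analyticOnNhd isOpen_ball).eqOn_zero_of_preconnected_of_eventuallyEq_zero
    (convex_ball E.t r).isPreconnected (mem_ball_self hr) hzero
  exact hvt (hindep _ _ fun z hz => heqOn hz.1).1

theorem IsApparent.hasRegularSolution {n : ℤ} (h : E.IsApparent n) : E.HasRegularSolution := by
  obtain ⟨r, hr, u, v, hu, -, hut, -, hsol, -⟩ := h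
  exact ⟨u, hu.analyticAt (ball_mem_nhds E.t hr), hut, hsol.eventually_heunOp_eq_zero hr⟩

theorem isExponents_one_sub {n : ℤ} (hε : E.ε = n) : E.IsExponents 0 0 (1 - n : ℤ) :=
  ⟨by ring, by ring, by rw [hε]; push_cast; ring⟩

theorem IsApparent.hasRegularSolution_gauge {n : ℤ} (hε : E.ε = n) (h : E.IsApparent n) :
    (E.gauge 0 0 (1 - n : ℤ)).HasRegularSolution := by
  obtain ⟨r, hr, u, v, -, hv, -, hvt, -, hsol, -⟩ := h
  have hva : AnalyticAt ℂ v E.t := hv.analyticAt (ball_mem_nhds E.t hr)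
  refine ⟨v, hva, hvt, ?_⟩
  filter_upwards [eventually_mem_domain, hsol.eventually_heunOp_eq_zero hr,
    nhdsWithin_le_nhds hva.eventually_analyticAt] with z hz hsolz hvz
  have hpow : ∀ᶠ x in 𝓝 z, HasDerivAt (fun w => (w - E.t) ^ (1 - n))
      (E.logDer 0 0 (1 - n : ℤ) x * (x - E.t) ^ (1 - n)) x := by
    filter_upwards [isOpen_domain.mem_nhds hz] with x hx using hasDerivAt_zpow_sub _ hx.2.2
  have hmul := (isExponents_one_sub hε).heunOp_mul hz hpow hvz
  exact (mul_eq_zero.1 (hmul.symm.trans hsolz)).resolve_left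
    (zpow_ne_zero _ (sub_ne_zero.2 hz.2.2))

theorem IsApparent.hasElementarySolution {m n : ℤ} (hα : E.α = m) (hε : E.ε = n)
    (h : E.IsApparent n) : E.HasElementarySolution := by
  rcases lt_trichotomy n 1 with hn | rfl | hn
  · obtain ⟨N, rfl⟩ := Int.exists_eq_neg_ofNat (Int.lt_add_one_iff.1 hn : n ≤ 0)
    exact h.hasRegularSolution.hasElementarySolution hα (by simpa using hε)
  · exact absurd h (not_isApparent_one (by simpa using hε))
  · obtain ⟨N, rfl⟩ : ∃ N : ℕ, n = N + 2 := ⟨(n - 2).toNat, by omega⟩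
    refine .of_gauge (isExponents_one_sub hε) ((h.hasRegularSolution_gauge hε).hasElementarySolution
      (m := m + (1 - (N + 2))) (N := N) ?_ ?_)
    · simp [gauge, hα]
    · simp only [gauge, hε]
      push_cast
      ring

end ApparentSingularity

section Reducibility

/-- The equation `φ' = logDer φ` for `φ = z ^ a (z - 1) ^ b (z - t) ^ c`. -/
noncomputable def logDerSystem (a b c z : ℂ) : ℂ →L[ℂ] ℂ :=
  E.logDer a b c z • ContinuousLinearMap.id ℂ ℂ

/-- The Heun equation as a first order system for `(y, y')`. -/
noncomputable def heunSystem (z : ℂ) : ℂ × ℂ →L[ℂ] ℂ × ℂ :=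
  .inl ℂ ℂ ℂ ∘L .snd ℂ ℂ ℂ - E.logDer E.γ E.δ E.ε z • (.inr ℂ ℂ ℂ ∘L .snd ℂ ℂ ℂ)
    - ((E.α * E.β * z - E.q) / (z * (z - 1) * (z - E.t))) • (.inr ℂ ℂ ℂ ∘L .fst ℂ ℂ ℂ)

/-- The solutions `φ p`, where `φ` runs over the multiples of the multivalued function
`z ^ a (z - 1) ^ b (z - t) ^ c`. -/
def elementarySubrepresentation (a b c : ℂ) (p : ℂ[X]) (b₀ : E.domain) :
    Subrepresentation (E.monodromy b₀) where
  toSubmodule :=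
    { carrier := {F | ∃ Φ, IsMultivaluedODESolution (E.logDerSystem a b c) Φ ∧
        ∀ x, F.1 x = Φ x * p.eval (x.1 : ℂ)}
      add_mem' := by
        rintro F G ⟨Φ, hΦ, hF⟩ ⟨Ψ, hΨ, hG⟩
        exact ⟨Φ + Ψ, hΦ.add hΨ, fun x => by simp [hF x, hG x, add_mul]⟩
      zero_mem' := ⟨0, fun x g => ⟨1, one_pos, 0, fun z _ => by simp,
        fun _ _ _ => rfl⟩, fun x => by simp⟩
      smul_mem' := by
        rintro k F ⟨Φ, hΦ, hF⟩
        exact ⟨k • Φ, hΦ.const_smul k, fun x => by simp [hF x, mul_assoc]⟩ }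
  apply_mem_toSubmodule := by
    rintro σ F ⟨Φ, hΦ, hF⟩
    exact ⟨_, hΦ.translate σ.toPath, fun x => hF ⟨x.1, _⟩⟩

variable {E} {a b c : ℂ} {p : ℂ[X]} {U : Set ℂ} {b₀ : E.domain}

theorem differentiableOn_logDer : DifferentiableOn ℂ (E.logDer a b c) E.domain := fun _ hz =>
  (hasDerivAt_logDer hz).differentiableAt.differentiableWithinAt

theorem differentiableOn_logDerSystem :
    DifferentiableOn ℂ (E.logDerSystem a b c) E.domain :=
  differentiableOn_logDer.smul_const _

theorem differentiableOn_heunSystem : DifferentiableOn ℂ E.heunSystem E.domain := by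
  refine ((differentiableOn_const _).sub (differentiableOn_logDer.smul_const _)).sub
    (DifferentiableOn.smul_const ?_ _)
  rintro z ⟨h0, h1, ht⟩
  have hden : z * (z - 1) * (z - E.t) ≠ 0 :=
    mul_ne_zero (mul_ne_zero h0 (sub_ne_zero.2 h1)) (sub_ne_zero.2 ht)
  exact DifferentiableAt.differentiableWithinAt (by fun_prop (disch := exact hden))

theorem hasDerivAt_fst_of_heunSystem {Y : ℂ → ℂ × ℂ} (hY : SolvesLinearODE E.heunSystem U Y) {z : ℂ}
    (hz : z ∈ U) : HasDerivAt (Prod.fst ∘ Y) (Y z).2 z := by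
  simpa [heunSystem] using
    (ContinuousLinearMap.fst ℂ ℂ ℂ).hasFDerivAt.comp_hasDerivAt z (hY z hz)

theorem hasDerivAt_snd_of_heunSystem {Y : ℂ → ℂ × ℂ} (hY : SolvesLinearODE E.heunSystem U Y) {z : ℂ}
    (hz : z ∈ U) : HasDerivAt (Prod.snd ∘ Y) (-(E.logDer E.γ E.δ E.ε z * (Y z).2)
      - (E.α * E.β * z - E.q) / (z * (z - 1) * (z - E.t)) * (Y z).1) z := by
  simpa [heunSystem] using
    (ContinuousLinearMap.snd ℂ ℂ ℂ).hasFDerivAt.comp_hasDerivAt z (hY z hz)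

theorem isSolutionOn_fst (hU : IsOpen U) (hUE : U ⊆ E.domain) {Y : ℂ → ℂ × ℂ}
    (hY : SolvesLinearODE E.heunSystem U Y) : E.IsSolutionOn U (Prod.fst ∘ Y) := by
  have hderiv : Set.EqOn (deriv (Prod.fst ∘ Y)) (Prod.snd ∘ Y) U := fun _ hz =>
    (hasDerivAt_fst_of_heunSystem hY hz).deriv
  refine ⟨hUE, hY.differentiableOn.fst, fun z hz => ?_⟩
  rw [hderiv.deriv hU hz, hderiv hz, (hasDerivAt_snd_of_heunSystem hY hz).deriv]
  simp only [logDer, Function.comp_apply]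
  ring

theorem IsExponents.isSolutionOn_mul_eval (habc : E.IsExponents a b c)
    (hp : (E.gauge a b c).polyOp p = 0) (hU : IsOpen U) (hUE : U ⊆ E.domain) {φ : ℂ → ℂ}
    (hφ : SolvesLinearODE (E.logDerSystem a b c) U φ) :
    E.IsSolutionOn U (φ * fun z => p.eval z) := by
  refine isSolutionOn_iff.2
    ⟨hUE, hφ.differentiableOn.mul p.differentiable.differentiableOn, fun z hz => ?_⟩
  rw [habc.heunOp_mul (hUE hz) (by filter_upwards [hU.mem_nhds hz] using hφ)
    (p.differentiable.analyticAt z), heunOp_eval, hp, eval_zero, mul_zero]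

theorem isMultivaluedSolution_fst {Ψ : E.UniversalCover b₀ → ℂ × ℂ}
    (hΨ : IsMultivaluedODESolution E.heunSystem Ψ) :
    E.IsMultivaluedSolution b₀ (Prod.fst ∘ Ψ) := fun _ g => by
  obtain ⟨r, hr, hsub, Y, hY, hbranch⟩ := hΨ.exists_branch_subset isOpen_domain g
  exact ⟨r, hr, _, isSolutionOn_fst isOpen_ball hsub hY, hbranch.comp Prod.fst⟩

theorem IsExponents.isMultivaluedSolution_mul_eval (habc : E.IsExponents a b c)
    (hp : (E.gauge a b c).polyOp p = 0) {Φ : E.UniversalCover b₀ → ℂ}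
    (hΦ : IsMultivaluedODESolution (E.logDerSystem a b c) Φ) :
    E.IsMultivaluedSolution b₀ fun x => Φ x * p.eval (x.1 : ℂ) := fun _ g => by
  obtain ⟨r, hr, hsub, φ, hφ, hbranch⟩ := hΦ.exists_branch_subset isOpen_domain g
  exact ⟨r, hr, _, habc.isSolutionOn_mul_eval hp isOpen_ball hsub hφ,
    fun z s hs => congrArg (· * p.eval (z : ℂ)) (hbranch z s hs)⟩

theorem IsExponents.elementarySubrepresentation_ne_bot (habc : E.IsExponents a b c) (hp0 : p ≠ 0)
    (hp : (E.gauge a b c).polyOp p = 0) : E.elementarySubrepresentation a b c p b₀ ≠ ⊥ := by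
  intro hbot
  obtain ⟨Φ, hΦ, hΦb⟩ := IsMultivaluedODESolution.exists_apply_refl_eq isOpen_domain
    (E.differentiableOn_logDerSystem (a := a) (b := b) (c := c)) b₀ 1
  let F : E.solutions b₀ :=
    ⟨fun x => Φ x * p.eval (x.1 : ℂ), habc.isMultivaluedSolution_mul_eval hp hΦ⟩
  have hF : F = 0 := by
    have hmem : F ∈ E.elementarySubrepresentation a b c p b₀ := ⟨Φ, hΦ, fun _ => rfl⟩
    rwa [hbot] at hmem
  obtain ⟨r, hr, hsub, φ, hφ, hbranch⟩ := hΦ.exists_branch_subset isOpen_domain (.refl b₀)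
  have hφb : φ b₀ ≠ 0 := by
    rw [← hbranch.apply_eq hr, hΦb]
    exact one_ne_zero
  have hroot : ∀ᶠ z in 𝓝 (b₀ : ℂ), p.IsRoot z := by
    filter_upwards [ball_mem_nhds (b₀ : ℂ) hr,
      (hφ b₀ (mem_ball_self hr)).continuousAt.eventually_ne hφb] with z hz hφz
    obtain ⟨s, hs⟩ := IsBranch.exists_path_mem_ball hsub hz
    have hzero := congrFun (congrArg Subtype.val hF) ⟨_, .trans (.refl b₀) (.mk s)⟩
    simp only [F, hbranch _ s hs] at hzero
    exact (mul_eq_zero.1 hzero).resolve_left hφz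
  exact hp0 (eq_zero_of_infinite_isRoot p (infinite_of_mem_nhds _ hroot))

theorem exists_smul_eq_of_mem_elementarySubrepresentation {Ψ : E.UniversalCover b₀ → ℂ × ℂ}
    (hΨ : IsMultivaluedODESolution E.heunSystem Ψ)
    (hmem : ⟨_, isMultivaluedSolution_fst hΨ⟩ ∈ E.elementarySubrepresentation a b c p b₀) :
    ∃ k : ℂ, k • ((p.eval (b₀ : ℂ),
      E.logDer a b c b₀ * p.eval (b₀ : ℂ) + (derivative p).eval (b₀ : ℂ)) : ℂ × ℂ)
        = Ψ ⟨b₀, .refl b₀⟩ := by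
  obtain ⟨Φ, hΦ, hΨΦ⟩ := hmem
  obtain ⟨ρ, hρ, hsub, Y, hY, hYbranch⟩ := hΨ.exists_branch_subset isOpen_domain (.refl b₀)
  obtain ⟨r, hr, hrρ, φ, hφ, hφbranch⟩ := hΦ.exists_branch_le (.refl b₀) hρ
  have hrsub := ball_subset_ball (x := (b₀ : ℂ)) hrρ
  have hb₀ : (b₀ : ℂ) ∈ ball (b₀ : ℂ) r := mem_ball_self hr
  have heqOn : Set.EqOn (Prod.fst ∘ Y) (fun z => φ z * p.eval z) (ball b₀ r) :=
    IsBranch.eqOn (hrsub.trans hsub) ((hYbranch.comp Prod.fst).mono hrρ) fun z s hs => by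
      rw [← hφbranch z s hs]
      exact hΨΦ ⟨z, _⟩
  have hderiv := (hasDerivAt_fst_of_heunSystem hY (hrsub hb₀)).unique
    (((hφ b₀ hb₀).mul (p.hasDerivAt b₀)).congr_of_eventuallyEq
      (heqOn.eventuallyEq_of_mem (ball_mem_nhds _ hr)))
  refine ⟨φ b₀, ?_⟩
  rw [hYbranch.apply_eq hρ]
  refine Prod.ext (heqOn hb₀).symm ?_
  rw [hderiv]
  simp only [logDerSystem, smul_apply, ContinuousLinearMap.id_apply,
    Prod.smul_mk, smul_eq_mul]
  ring

theorem elementarySubrepresentation_ne_top : E.elementarySubrepresentation a b c p b₀ ≠ ⊤ := by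
  intro htop
  have hline := finrank_le_one (R := ℂ) (M := ℂ × ℂ) _ fun v => by
    obtain ⟨Ψ, hΨ, hΨb⟩ := IsMultivaluedODESolution.exists_apply_refl_eq isOpen_domain
      E.differentiableOn_heunSystem b₀ v
    rw [← hΨb]
    exact exists_smul_eq_of_mem_elementarySubrepresentation (a := a) (b := b) (c := c) (p := p) hΨ
      (by rw [htop]; trivial)
  simp at hline

theorem HasElementarySolution.isMonodromyReducible (h : E.HasElementarySolution) (b : E.domain) :
    E.IsMonodromyReducible b := by
  obtain ⟨a₀, a₁, aₜ, p, hexp, hp0, hp⟩ := h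
  exact ⟨E.elementarySubrepresentation a₀ a₁ aₜ p b,
    hexp.elementarySubrepresentation_ne_bot hp0 hp, elementarySubrepresentation_ne_top⟩

end Reducibility

end HeunEquation

theorem mainTheorem6 (E : HeunEquation) (m n : ℤ) (hα : E.α = (m : ℂ)) (hε : E.ε = (n : ℂ))
    (happ : E.IsApparent n) (b : E.domain) : E.IsMonodromyReducible b :=
  (happ.hasElementarySolution hα hε).isMonodromyReducible b
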